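/- **Setting.** Let $(\Omega,\mathcal F,\mathbb P)$ be a probability space and $\mathcal D(\mathbb R^d)$ the space of smooth compactly supported real functions with its usual topology. A *generalized random process* is a family of real random variables $\langle \dot X,\varphi\rangle$, $\varphi\in\mathcal D(\mathbb R^d)$, which is almost surely linear in $\varphi$ and such that $\varphi_n\to\varphi$ in $\mathcal D(\mathbb R^d)$ implies $\langle\dot X,\varphi_n\rangle\to\langle\dot X,\varphi\rangle$ in probability. A *Lévy exponent* is a continuous function $\psi:\mathbb R\to\mathbb C$ with $\psi(0)=0$ such that $e^{\psi}$ is the characteristic function of an infinitely divisible law on $\mathbb R$. A *Lévy white noise* with Lévy exponent $\psi$ is a generalized random process $\dot X$ with $$\mathbb E\big[e^{\mathrm i\langle \dot X,\varphi\rangle}\big]=\exp\Big(\int_{\mathbb R^d}\psi(\varphi(t))\,\mathrm dt\Big)\qquad\text{for all }\varphi\in\mathcal D(\mathbb R^d).$$ **Extension to indicator functions.** All limits are in probability, and all random variables are determined up to almost sure equality. 1. For $A\subset\mathbb R^d$ Borel and $\varphi\in\mathcal D(\mathbb R^d)$, $\langle\dot X,\varphi 1_A\rangle:=\lim_{n\to\infty}\langle\dot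 X,\varphi\,(\theta_n*1_A)\rangle$, where $\theta_n(t)=n^d\theta(nt)$, $n\ge1$, and the limit is required to exist and to be the same for every $\theta\in\mathcal D(\mathbb R^d)$ with $\theta\ge0$ and $\int\theta=1$. 2. For $A$ bounded Borel, $\langle\dot X,1_A\rangle:=\langle\dot X,\varphi 1_A\rangle$, which is required to be the same for every $\varphi\in\mathcal D(\mathbb R^d)$ with $\varphi=1$ on $A$. 3. For $A$ Borel with $\mathrm{Leb}(A)<\infty$, $\langle\dot X,1_A\rangle:=\lim_{n\to\infty}\langle\dot X,1_{A\cap[-n,n]^d}\rangle$. Let $\mathcal L(\mathbb R^d)$ be the collection of Borel subsets of $\mathbb R^d$ of finite Lebesgue measure. **Theorem.** Let $\dot X$ be a Lévy white noise on $\mathbb R^d$ with Lévy exponent $\psi$. Then for every $A\in\mathcal L(\mathbb R^d)$ the random variable $\langle\dot X,1_A\rangle$ is well defined: it exists, and it is unique up to almost sure equality. Moreover, for every choice of versions of the random variables $\langle\dot X,1_A\rangle$, $A\in\mathcal L(\mathbb R^d)$: * for all $A\in\mathcal L(\mathbb R^d)$ and $\xi\in\mathbb R$, $\ \mathbb E\big[e^{\mathrm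 i\xi\langle\dot X,1_A\rangle}\big]=\exp\big(\mathrm{Leb}(A)\,\psi(\xi)\big)$; * $A\mapsto\langle\dot X,1_A\rangle$ is an independently scattered random measure on $\mathcal L(\mathbb R^d)$ in the sense of Rajput and Rosiński. That is: $\mathcal L(\mathbb R^d)$ is a $\delta$-ring (nonempty and closed under finite unions, relative complements and countable intersections) which contains an increasing sequence of sets with union $\mathbb R^d$; and for every sequence $(A_n)_{n\in\mathbb N}$ of pairwise disjoint sets in $\mathcal L(\mathbb R^d)$, the random variables $\langle\dot X,1_{A_n}\rangle$, $n\in\mathbb N$, are independent and, if $\bigcup_nA_n\in\mathcal L(\mathbb R^d)$, then $\langle\dot X,1_{\bigcup_nA_n}\rangle=\sum_n\langle\dot X,1_{A_n}\rangle$ almost surely, where the series converges almost surely. -/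

import Mathlib

open MeasureTheory Filter TopologicalSpace
open scoped Topology Convolution

namespace LevyNoise

noncomputable section

/-- Euclidean space `ℝ^d`. -/
abbrev Space (d : ℕ) : Type := EuclideanSpace ℝ (Fin d)

/-- The space `𝓓(ℝ^d)` of smooth, compactly supported real functions, with Mathlib's
canonical LF topology (here `⊤ : ℕ∞`, that is, infinitely differentiable). -/
abbrev TestFn (d : ℕ) : Type := TestFunction (⊤ : Opens (Space d)) ℝ (⊤ : ℕ∞)

/-! ### Generalized random processes and Lévy white noises -/

/-- A generalized random process: a family of random variables indexed by test functions, almost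
surely linear, and sequentially continuous for convergence in probability. -/
structure IsGeneralizedRandomProcess {d : ℕ} {Ω : Type*} [MeasurableSpace Ω] (P : Measure Ω)
    (X : TestFn d → Ω → ℝ) : Prop where
  measurable : ∀ φ, Measurable (X φ)
  linear : ∀ (φ₁ φ₂ : TestFn d) (c : ℝ),
    ∀ᵐ ω ∂P, X (φ₁ + c • φ₂) ω = X φ₁ ω + c * X φ₂ ω
  continuous : ∀ (φs : ℕ → TestFn d) (φ : TestFn d), Tendsto φs atTop (𝓝 φ) →
    TendstoInMeasure P (fun n => X (φs n)) atTop (X φ)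

/-- A law on `ℝ` is infinitely divisible if, for every `N ≥ 1`, it is the law of a sum of `N`
independent, identically distributed random variables. -/
def IsInfinitelyDivisible (μ : Measure ℝ) : Prop :=
  ∀ N : ℕ, 0 < N → ∃ ν : Measure ℝ, IsProbabilityMeasure ν ∧
    (Measure.pi (fun _ : Fin N => ν)).map (fun x => ∑ i, x i) = μ

/-- A Lévy exponent: the continuous logarithm, vanishing at `0`, of the characteristic function of
an infinitely divisible law. -/
def IsLevyExponent (ψ : ℝ → ℂ) : Prop :=
  Continuous ψ ∧ ψ 0 = 0 ∧ ∃ μ : Measure ℝ, IsProbabilityMeasure μ ∧ IsInfinitelyDivisible μ ∧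
    ∀ ξ : ℝ, ∫ x, Complex.exp (Complex.I * ξ * x) ∂μ = Complex.exp (ψ ξ)

/-- `X` is a Lévy white noise on `ℝ^d` with Lévy exponent `ψ`. -/
structure IsLevyWhiteNoise {d : ℕ} {Ω : Type*} [MeasurableSpace Ω] (P : Measure Ω)
    (X : TestFn d → Ω → ℝ) (ψ : ℝ → ℂ) : Prop extends IsGeneralizedRandomProcess P X where
  levyExponent : IsLevyExponent ψ
  charFunctional : ∀ φ : TestFn d,
    ∫ ω, Complex.exp (Complex.I * X φ ω) ∂P = Complex.exp (∫ t : Space d, ψ (φ t))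

/-! ### Extension to indicator functions -/

/-- `θ ∈ 𝓓(ℝ^d)` is nonnegative with integral one. -/
def IsMollifier {d : ℕ} (θ : TestFn d) : Prop :=
  (∀ t, 0 ≤ θ t) ∧ ∫ t, θ t = 1

/-- The rescaled function `θ_m(t) = m^d θ(m t)`, with `m = n + 1 ≥ 1`. -/
def scaled {d : ℕ} (θ : TestFn d) (n : ℕ) : Space d → ℝ :=
  fun t => ((n : ℝ) + 1) ^ d * θ (((n : ℝ) + 1) • t)

lemma contDiff_scaled {d : ℕ} (θ : TestFn d) (n : ℕ) : ContDiff ℝ (⊤ : ℕ∞) (scaled θ n) :=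
  contDiff_const.mul (θ.contDiff.comp (contDiff_const_smul _))

lemma hasCompactSupport_scaled {d : ℕ} (θ : TestFn d) (n : ℕ) :
    HasCompactSupport (scaled θ n) :=
  (θ.hasCompactSupport.comp_smul (by positivity : (n : ℝ) + 1 ≠ 0)).mul_left

/-- The function `θ_m * 1_A`, with `m = n + 1`. -/
def smoothedIndicator {d : ℕ} (θ : TestFn d) (n : ℕ) (A : Set (Space d)) : Space d → ℝ :=
  scaled θ n ⋆[ContinuousLinearMap.mul ℝ ℝ, volume] A.indicator (fun _ => (1 : ℝ))

lemma contDiff_smoothedIndicator {d : ℕ} (θ : TestFn d) (n : ℕ) {A : Set (Space d)}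
    (hA : MeasurableSet A) : ContDiff ℝ (⊤ : ℕ∞) (smoothedIndicator θ n A) :=
  (hasCompactSupport_scaled θ n).contDiff_convolution_left _ (contDiff_scaled θ n)
    ((locallyIntegrable_const (1 : ℝ)).indicator hA)

/-- The test function `φ · (θ_m * 1_A)`, with `m = n + 1`. -/
def mollifiedProduct {d : ℕ} (φ θ : TestFn d) (n : ℕ) (A : Set (Space d))
    (hA : MeasurableSet A) : TestFn d where
  toFun t := φ t * smoothedIndicator θ n A t
  contDiff' := φ.contDiff.mul (contDiff_smoothedIndicator θ n hA)
  hasCompactSupport' := φ.hasCompactSupport.mul_right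
  tsupport_subset' := by simp

/-- `Y` is (a version of) `⟨X, φ 1_A⟩`: for every mollifier `θ`, it is the limit in probability of
`⟨X, φ · (θ_m * 1_A)⟩` as `m → ∞`. -/
def IsProductExtension {d : ℕ} {Ω : Type*} [MeasurableSpace Ω] (P : Measure Ω)
    (X : TestFn d → Ω → ℝ) (φ : TestFn d) (A : Set (Space d)) (hA : MeasurableSet A)
    (Y : Ω → ℝ) : Prop :=
  Measurable Y ∧ ∀ θ : TestFn d, IsMollifier θ →
    TendstoInMeasure P (fun n => X (mollifiedProduct φ θ n A hA)) atTop Y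

/-- For bounded Borel `A`, `Y` is (a version of) `⟨X, 1_A⟩`: it is a version of `⟨X, φ 1_A⟩` for
every test function `φ` equal to `1` on `A`. -/
def IsBoundedIndicatorExtension {d : ℕ} {Ω : Type*} [MeasurableSpace Ω] (P : Measure Ω)
    (X : TestFn d → Ω → ℝ) (A : Set (Space d)) (hA : MeasurableSet A) (Y : Ω → ℝ) : Prop :=
  ∀ φ : TestFn d, (∀ t ∈ A, φ t = 1) → IsProductExtension P X φ A hA Y

/-- The cube `[-n, n]^d`. -/
def cube (d n : ℕ) : Set (Space d) := {t | ∀ i, |t i| ≤ n}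

lemma measurableSet_cube (d n : ℕ) : MeasurableSet (cube d n) := by
  have : cube d n = ⋂ i, {t : Space d | |t i| ≤ n} := by ext; simp [cube]
  rw [this]
  exact MeasurableSet.iInter fun i => measurableSet_le (by fun_prop) measurable_const

/-- For a Borel set `A` of finite Lebesgue measure, `Y` is (a version of) `⟨X, 1_A⟩`: it is the
limit in probability of `⟨X, 1_{A ∩ [-n, n]^d}⟩` as `n → ∞`. -/
def IsIndicatorExtension {d : ℕ} {Ω : Type*} [MeasurableSpace Ω] (P : Measure Ω)
    (X : TestFn d → Ω → ℝ) (A : Set (Space d)) (hA : MeasurableSet A) (Y : Ω → ℝ) : Prop :=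
  Measurable Y ∧ ∃ Ys : ℕ → Ω → ℝ,
    (∀ n, IsBoundedIndicatorExtension P X (A ∩ cube d n)
      (hA.inter (measurableSet_cube d n)) (Ys n)) ∧
    TendstoInMeasure P Ys atTop Y

/-! ### Independently scattered random measures -/

/-- A `δ`-ring of sets: a nonempty collection closed under finite unions, relative complements and
countable intersections. -/
structure IsDeltaRing {S : Type*} (𝒮 : Set (Set S)) : Prop where
  nonempty : 𝒮.Nonempty
  union : ∀ A ∈ 𝒮, ∀ B ∈ 𝒮, A ∪ B ∈ 𝒮
  diff : ∀ A ∈ 𝒮, ∀ B ∈ 𝒮, A \ B ∈ 𝒮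
  iInter : ∀ A : ℕ → Set S, (∀ n, A n ∈ 𝒮) → (⋂ n, A n) ∈ 𝒮

/-- An independently scattered random measure (Rajput–Rosiński) on a `δ`-ring `𝒮` of subsets of `S`
which contains an increasing sequence of sets exhausting `S`. The values `Λ A` with `A ∉ 𝒮` are
irrelevant. -/
structure IsIndependentlyScatteredRandomMeasure {S Ω : Type*} [MeasurableSpace Ω]
    (P : Measure Ω) (𝒮 : Set (Set S)) (Λ : Set S → Ω → ℝ) : Prop where
  deltaRing : IsDeltaRing 𝒮
  exhaust : ∃ B : ℕ → Set S, (∀ n, B n ∈ 𝒮) ∧ Monotone B ∧ (⋃ n, B n) = Set.univ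
  measurable : ∀ A ∈ 𝒮, Measurable (Λ A)
  indep : ∀ A : ℕ → Set S, (∀ n, A n ∈ 𝒮) → Pairwise (Function.onFun Disjoint A) →
    ProbabilityTheory.iIndepFun (fun n => Λ (A n)) P
  additive : ∀ A : ℕ → Set S, (∀ n, A n ∈ 𝒮) → Pairwise (Function.onFun Disjoint A) →
    (⋃ n, A n) ∈ 𝒮 →
    ∀ᵐ ω ∂P, Tendsto (fun N => ∑ n ∈ Finset.range N, Λ (A n) ω) atTop (𝓝 (Λ (⋃ n, A n) ω))

/-- The Borel subsets of `ℝ^d` of finite Lebesgue measure. -/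
def finiteBorel (d : ℕ) : Set (Set (Space d)) := {A | MeasurableSet A ∧ volume A < ⊤}

end

end LevyNoise

/-! Everything follows from `E exp(i⟨X,f⟩) = exp ∫ ψ(f)`. As `ψ` is continuous with `ψ 0 = 0`, the
right side is stable under bounded a.e. convergence inside a set of finite measure. Applied to
`ξ(φ_m - φ_n)`, this sends the characteristic functions of differences to `1`, which forces
convergence in probability to `0`. Hence bounded approximations of `f` by test functions with
supports in one compact set give Cauchy sequences (`TestApprox.exists_isApprox`), the formula
survives in the limit (`IsApprox.integral_exp`), and two limits for the same `f` differ by a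
variable with characteristic function `1`, so they agree a.s. (`IsApprox.ae_eq`). Lebesgue
differentiation puts mollified indicators in this setting; truncation by cubes is handled by the
same estimate.

The result is a joint characteristic function for finitely many sets
(`integral_exp_sum_indicatorExtension`). It factorizes over disjoint sets, giving independence, and
equals `1` on linear relations between indicators, giving finite additivity.

For countable additivity, write `S = T n + R n`: the value on the union, a partial sum, and the
value on the tail set, which is independent of the past. Then `E[exp(iξS) | ℱ n] = exp(iξ T n) · E
exp(iξ R n)`. The left side tends a.s. to `exp(iξS)` by Lévy's upward theorem and the last factor
tends to `1`, so `exp(iξ T n) → exp(iξS)` a.s., with no moment assumption. Fubini makes the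
exceptional null set independent of `ξ`, up to a null set of `ξ`, and this determines the limit of
`T n` (`ae_tendsto_of_indep_remainder`). -/

namespace LevyNoise

/-! ### Convergence in probability and independence through characteristic functions. -/

section Probability

open ProbabilityTheory

variable {Ω ι : Type*} [MeasurableSpace Ω] {P : Measure Ω}

lemma tendstoInMeasure_add {l : Filter ι} {Z W : ι → Ω → ℝ} {Y V : Ω → ℝ}
    (hZ : TendstoInMeasure P Z l Y) (hW : TendstoInMeasure P W l V) :
    TendstoInMeasure P (fun i ω => Z i ω + W i ω) l (fun ω => Y ω + V ω) := by
  rw [tendstoInMeasure_iff_norm] at *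
  intro ε hε
  have h := (hZ (ε / 2) (half_pos hε)).add (hW (ε / 2) (half_pos hε))
  rw [add_zero] at h
  refine tendsto_of_tendsto_of_tendsto_of_le_of_le tendsto_const_nhds h (fun _ => zero_le) ?_
  intro i
  refine (measure_mono ?_).trans (measure_union_le _ _)
  intro ω hω
  simp only [Set.mem_ofPred_eq, Set.mem_union, Real.norm_eq_abs] at *
  by_contra! hc
  have h1 := abs_add_le (Z i ω - Y ω) (W i ω - V ω)
  rw [show Z i ω - Y ω + (W i ω - V ω) = Z i ω + W i ω - (Y ω + V ω) by ring] at h1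
  linarith [hc.1, hc.2]

lemma tendstoInMeasure_const_mul {l : Filter ι} {Z : ι → Ω → ℝ} {Y : Ω → ℝ} (c : ℝ)
    (hZ : TendstoInMeasure P Z l Y) :
    TendstoInMeasure P (fun i ω => c * Z i ω) l (fun ω => c * Y ω) := by
  rw [tendstoInMeasure_iff_norm] at *
  intro ε hε
  have hc : 0 < |c| + 1 := by positivity
  refine tendsto_of_tendsto_of_tendsto_of_le_of_le tendsto_const_nhds
    (hZ (ε / (|c| + 1)) (div_pos hε hc)) (fun _ => zero_le) ?_
  intro i
  refine measure_mono ?_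
  intro ω hω
  simp only [Set.mem_ofPred_eq, Real.norm_eq_abs, ← mul_sub, abs_mul] at *
  rw [div_le_iff₀ hc]
  nlinarith [abs_nonneg (Z i ω - Y ω)]

lemma tendstoInMeasure_of_sub {l : Filter ι} {Z : ι → Ω → ℝ} {Y : Ω → ℝ}
    (hZ : TendstoInMeasure P (fun i ω => Y ω - Z i ω) l 0) :
    TendstoInMeasure P Z l Y := by
  rw [tendstoInMeasure_iff_norm] at *
  simpa [abs_sub_comm] using hZ

lemma norm_exp_I_mul_ofReal (x : ℝ) : ‖Complex.exp (Complex.I * x)‖ = 1 := by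
  rw [mul_comm, Complex.norm_exp_ofReal_mul_I]

lemma tendsto_integral_exp_of_tendstoInMeasure [IsFiniteMeasure P] {Z : ℕ → Ω → ℝ} {Y : Ω → ℝ}
    (hZm : ∀ n, Measurable (Z n)) (hZ : TendstoInMeasure P Z atTop Y) :
    Tendsto (fun n => ∫ ω, Complex.exp (Complex.I * Z n ω) ∂P) atTop
      (𝓝 (∫ ω, Complex.exp (Complex.I * Y ω) ∂P)) := by
  -- Every subsequence has an a.s. convergent further subsequence, along which dominated convergence
  -- applies with bound `1`.
  refine tendsto_of_subseq_tendsto fun ns hns => ?_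
  obtain ⟨ms, -, hms⟩ := (hZ.comp hns).exists_seq_tendsto_ae
  refine ⟨ms, tendsto_integral_of_dominated_convergence (fun _ => 1) ?_ (integrable_const _) ?_ ?_⟩
  · intro n
    have := hZm (ns (ms n))
    exact Measurable.aestronglyMeasurable (by fun_prop)
  · exact fun n => ae_of_all _ fun ω => (norm_exp_I_mul_ofReal _).le
  · filter_upwards [hms] with ω hω
    have hc : Continuous fun x : ℝ => Complex.exp (Complex.I * x) := by fun_prop
    exact (hc.tendsto _).comp hω

/-- Convergence of characteristic functions to `1` (almost everywhere) implies convergence in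
probability to `0`. -/
lemma tendstoInMeasure_zero_of_tendsto_charFun [IsProbabilityMeasure P] {l : Filter ι}
    [l.IsCountablyGenerated] {Z : ι → Ω → ℝ} (hZm : ∀ i, Measurable (Z i))
    (h : ∀ᵐ ξ : ℝ, Tendsto (fun i => ∫ ω, Complex.exp (Complex.I * ↑(ξ * Z i ω)) ∂P) l (𝓝 1)) :
    TendstoInMeasure P Z l 0 := by
  rw [tendstoInMeasure_iff_measureReal_norm]
  intro ε hε
  -- The tail bound used below controls the strict event `r < |x|`, while convergence in measure
  -- asks for `ε ≤ |x|`; any `r < ε` bridges the two.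
  set r : ℝ := ε / 2
  have hr : 0 < r := half_pos hε
  have hprob : ∀ i, IsProbabilityMeasure (P.map (Z i)) := fun i =>
    Measure.isProbabilityMeasure_map (hZm i).aemeasurable
  have hchar : ∀ i ξ, charFun (P.map (Z i)) ξ = ∫ ω, Complex.exp (Complex.I * ↑(ξ * Z i ω)) ∂P := by
    intro i ξ
    rw [charFun_apply_real, integral_map (hZm i).aemeasurable
      (Measurable.aestronglyMeasurable (by fun_prop))]
    refine integral_congr_ae (ae_of_all _ fun ω => ?_)
    simp only
    congr 1
    push_cast
    ring
  have hlim : Tendsto (fun i => ∫ ξ in (-2 * r⁻¹)..(2 * r⁻¹), 1 - charFun (P.map (Z i)) ξ) l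
      (𝓝 (∫ ξ in (-2 * r⁻¹)..(2 * r⁻¹), (0 : ℂ))) := by
    refine intervalIntegral.tendsto_integral_filter_of_dominated_convergence (fun _ => 2) ?_ ?_ ?_ ?_
    · exact Eventually.of_forall fun i =>
        (measurable_const.sub measurable_charFun).aestronglyMeasurable
    · exact Eventually.of_forall fun i => ae_of_all _ fun ξ _ => norm_one_sub_charFun_le_two
    · exact intervalIntegrable_const
    · filter_upwards [h] with ξ hξ _
      simp only [hchar]
      simpa using hξ.const_sub 1
  rw [intervalIntegral.integral_zero] at hlim
  have hlim' := (hlim.norm).const_mul (2⁻¹ * r)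
  rw [norm_zero, mul_zero] at hlim'
  refine tendsto_of_tendsto_of_tendsto_of_le_of_le tendsto_const_nhds hlim'
    (fun _ => measureReal_nonneg) fun i => ?_
  refine le_trans ?_ (measureReal_abs_gt_le_integral_charFun (μ := P.map (Z i)) hr)
  rw [map_measureReal_apply (hZm i) (measurableSet_lt measurable_const (by fun_prop))]
  refine measureReal_mono (fun ω hω => ?_)
  simp only [Set.mem_ofPred_eq, Set.mem_preimage, Real.norm_eq_abs, Pi.zero_apply, sub_zero] at *
  exact lt_of_lt_of_le (half_lt_self hε) hω

/-- A sequence which is Cauchy in probability converges in probability. -/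
lemma exists_tendstoInMeasure_of_cauchy [IsFiniteMeasure P] {Z : ℕ → Ω → ℝ}
    (hZm : ∀ n, Measurable (Z n))
    (h : TendstoInMeasure P (fun (p : ℕ × ℕ) ω => Z p.1 ω - Z p.2 ω) atTop 0) :
    ∃ Y, Measurable Y ∧ TendstoInMeasure P Z atTop Y := by
  rw [tendstoInMeasure_iff_norm] at h
  simp only [Pi.zero_apply, sub_zero] at h
  have key : ∀ k : ℕ, ∃ N, ∀ m ≥ N, ∀ n ≥ N,
      P {ω | (1 / 2 : ℝ) ^ k ≤ ‖Z m ω - Z n ω‖} ≤ (2⁻¹ : ENNReal) ^ k := by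
    intro k
    have h1 := ENNReal.tendsto_nhds_zero.1 (h ((1 / 2) ^ k) (by positivity)) ((2⁻¹ : ENNReal) ^ k)
      (ENNReal.pow_pos (by simp) _)
    rw [eventually_atTop] at h1
    obtain ⟨⟨a, b⟩, hab⟩ := h1
    exact ⟨max a b, fun m hm n hn => hab (m, n)
      ⟨(le_max_left _ _).trans hm, (le_max_right _ _).trans hn⟩⟩
  choose N hN using key
  obtain ⟨ns, hns, hnsN⟩ : ∃ ns : ℕ → ℕ, StrictMono ns ∧ ∀ k, N k ≤ ns k := by
    refine extraction_forall_of_eventually' (P := fun k n => N k ≤ n) fun k => ⟨N k, fun n hn => hn⟩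
  have hae : ∀ᵐ ω ∂P, ∃ y, Tendsto (fun k => Z (ns k) ω) atTop (𝓝 y) := by
    -- Borel–Cantelli: along `ns`, increments are eventually below `2⁻ᵏ`, so almost every path is
    -- Cauchy.
    have hsum : ∑' k, P {ω | (1 / 2 : ℝ) ^ k ≤ ‖Z (ns k) ω - Z (ns (k + 1)) ω‖} ≠ ⊤ := by
      refine ne_top_of_le_ne_top ?_ (ENNReal.tsum_le_tsum fun k =>
        hN k _ (hnsN k) _ ((hnsN k).trans (hns (Nat.lt_succ_self k)).le))
      simp
    filter_upwards [ae_eventually_notMem hsum] with ω hω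
    refine cauchySeq_tendsto_of_complete (cauchySeq_of_summable_dist ?_)
    refine Summable.of_norm_bounded_eventually_nat
      (summable_geometric_of_lt_one (r := (1 / 2 : ℝ)) (by norm_num) (by norm_num)) ?_
    filter_upwards [hω] with k hk
    simp only [not_le] at hk
    simpa [dist_eq_norm] using hk.le
  obtain ⟨Y, hYm, hY⟩ := measurable_limit_of_tendsto_metrizable_ae
    (fun k => (hZm (ns k)).aemeasurable) hae
  refine ⟨Y, hYm, ?_⟩
  have h1 := tendstoInMeasure_of_tendsto_ae (fun k => (hZm (ns k)).aestronglyMeasurable) hY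
  have h2 : TendstoInMeasure P (fun k ω => Z k ω - Z (ns k) ω) atTop (fun _ => 0) := by
    have ht : Tendsto (fun k => (k, ns k)) atTop (atTop : Filter (ℕ × ℕ)) := by
      rw [← prod_atTop_atTop_eq]
      exact tendsto_id.prodMk hns.tendsto_atTop
    rw [tendstoInMeasure_iff_norm]
    intro ε hε
    simpa [Function.comp_def] using (h ε hε).comp ht
  simpa using tendstoInMeasure_add h2 h1

/-- Finitely many random variables are independent if their joint characteristic function
factorizes. -/
lemma iIndepFun_of_charFun [IsProbabilityMeasure P] [Fintype ι] {Z : ι → Ω → ℝ}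
    (hZm : ∀ i, Measurable (Z i))
    (h : ∀ c : ι → ℝ, ∫ ω, Complex.exp (Complex.I * ↑(∑ i, c i * Z i ω)) ∂P =
      ∏ i, ∫ ω, Complex.exp (Complex.I * ↑(c i * Z i ω)) ∂P) :
    iIndepFun Z P := by
  rw [iIndepFun_iff_charFun_pi fun i => (hZm i).aemeasurable]
  intro t
  rw [charFun_apply, integral_map (by fun_prop) (Measurable.aestronglyMeasurable (by fun_prop))]
  convert h (fun i => t i) using 1
  · refine integral_congr_ae (ae_of_all _ fun ω => ?_)
    simp only [PiLp.inner_apply]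
    rw [mul_comm]
    simp
  · refine Finset.prod_congr rfl fun i _ => ?_
    rw [charFun_apply_real, integral_map (hZm i).aemeasurable
      (Measurable.aestronglyMeasurable (by fun_prop))]
    refine integral_congr_ae (ae_of_all _ fun ω => ?_)
    simp only
    congr 1
    push_cast
    ring

end Probability

/-! ### Almost sure convergence of series with independent remainders. -/

section Series

open ProbabilityTheory

variable {Ω : Type*} [mΩ : MeasurableSpace Ω] {P : Measure Ω}

/-- A real sequence tends to zero if its characters `exp (i ξ x n)` tend to `1` for almost every
`ξ`. -/
lemma tendsto_zero_of_ae_tendsto_exp {x : ℕ → ℝ}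
    (h : ∀ᵐ ξ : ℝ, Tendsto (fun n => Complex.exp (Complex.I * ↑(ξ * x n))) atTop (𝓝 1)) :
    Tendsto x atTop (𝓝 0) := by
  -- A deterministic sequence is a sequence of random variables on a one-point space, where an event
  -- of probability below `1` is empty.
  have h1 : TendstoInMeasure (Measure.dirac ()) (fun n _ => x n) atTop (fun _ => (0 : ℝ)) :=
    tendstoInMeasure_zero_of_tendsto_charFun (fun _ => measurable_const) (by simpa using h)
  rw [tendstoInMeasure_iff_dist] at h1
  rw [Metric.tendsto_atTop']
  intro ε hε
  obtain ⟨N, hN⟩ := eventually_atTop.1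
    ((h1 ε hε).eventually (gt_mem_nhds (zero_lt_one : (0 : ENNReal) < 1)))
  refine ⟨N, fun n hn => ?_⟩
  by_contra! hc
  rw [Real.dist_eq, sub_zero] at hc
  simpa [hc] using hN n hn.le

/-- Because `|exp(ix) - 1|² = 2 - 2 cos x`. -/
lemma exp_I_eq_one_of_cos {x : ℕ → ℝ} (h : Tendsto (fun n => Real.cos (x n)) atTop (𝓝 1)) :
    Tendsto (fun n => Complex.exp (Complex.I * x n)) atTop (𝓝 1) := by
  rw [tendsto_iff_norm_sub_tendsto_zero]
  have h2 : Tendsto (fun n => √(2 - 2 * Real.cos (x n))) atTop (𝓝 0) := by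
    have := ((h.const_mul 2).const_sub 2).sqrt
    simpa using this
  refine h2.congr fun n => ?_
  rw [Complex.norm_def, Complex.normSq_apply, mul_comm Complex.I, Complex.exp_mul_I]
  congr 1
  simp only [Complex.sub_re, Complex.add_re, Complex.mul_re, Complex.I_re, Complex.I_im,
    Complex.sub_im, Complex.add_im, Complex.mul_im, Complex.one_re, Complex.one_im,
    Complex.cos_ofReal_re, Complex.cos_ofReal_im, Complex.sin_ofReal_re, Complex.sin_ofReal_im]
  nlinarith [Real.sin_sq_add_cos_sq (x n)]

/-- The partial sums of a series of random variables converge almost surely if the remainders are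
independent of the past and tend to zero in probability. -/
lemma ae_tendsto_of_indep_remainder [IsProbabilityMeasure P] {ℱ : Filtration ℕ mΩ}
    {T R : ℕ → Ω → ℝ} {S : Ω → ℝ} (hT : ∀ n, Measurable[ℱ n] (T n)) (hR : ∀ n, Measurable (R n))
    (hS : Measurable S) (hTR : ∀ n, S =ᵐ[P] fun ω => T n ω + R n ω)
    (hind : ∀ n, Indep (MeasurableSpace.comap (R n) inferInstance) (ℱ n) P)
    (hlim : ∀ ξ : ℝ, Tendsto (fun n => ∫ ω, Complex.exp (Complex.I * ↑(ξ * R n ω)) ∂P) atTop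
      (𝓝 1)) :
    ∀ᵐ ω ∂P, Tendsto (fun n => T n ω) atTop (𝓝 (S ω)) := by
  have hTm : ∀ n, Measurable (T n) := fun n => (hT n).mono (ℱ.le n) le_rfl
  have hTS : TendstoInMeasure P T atTop S := by
    refine tendstoInMeasure_of_sub ?_
    refine (tendstoInMeasure_zero_of_tendsto_charFun hR (ae_of_all _ hlim)).congr_left fun n => ?_
    filter_upwards [hTR n] with ω hω
    simp [hω]
  -- `S` is an a.s. limit of a subsequence of `T`, so conditioning a function of `S` on `⨆ n, ℱ n`
  -- leaves it unchanged; this identifies the limit in Lévy's theorem.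
  have hSm : AEStronglyMeasurable[⨆ n, ℱ n] S P := by
    obtain ⟨ns, -, hns⟩ := hTS.exists_seq_tendsto_ae
    refine ⟨fun ω => limsup (fun k => T (ns k) ω) atTop, Measurable.stronglyMeasurable ?_, ?_⟩
    · exact Measurable.limsup fun k => (hT (ns k)).mono (le_iSup (fun n => ℱ n) (ns k)) le_rfl
    · filter_upwards [hns] with ω hω
      exact hω.limsup_eq.symm
  have hcis : ∀ (n : ℕ) (ξ : ℝ),
      Integrable (fun ω => Complex.exp (Complex.I * ↑(ξ * R n ω))) P := by
    intro n ξ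
    have := hR n
    exact Integrable.of_bound (Measurable.aestronglyMeasurable (by fun_prop)) 1
      (ae_of_all _ fun ω => (norm_exp_I_mul_ofReal _).le)
  have hre : ∀ (n : ℕ) (ξ : ℝ), ∫ ω, Real.cos (ξ * R n ω) ∂P =
      (∫ ω, Complex.exp (Complex.I * ↑(ξ * R n ω)) ∂P).re := by
    intro n ξ
    refine Eq.trans ?_ (integral_re (hcis n ξ))
    refine integral_congr_ae (ae_of_all _ fun ω => ?_)
    simp only [mul_comm Complex.I]
    exact (Complex.exp_ofReal_mul_I_re _).symm
  have him : ∀ (n : ℕ) (ξ : ℝ), ∫ ω, Real.sin (ξ * R n ω) ∂P =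
      (∫ ω, Complex.exp (Complex.I * ↑(ξ * R n ω)) ∂P).im := by
    intro n ξ
    refine Eq.trans ?_ (integral_im (hcis n ξ))
    refine integral_congr_ae (ae_of_all _ fun ω => ?_)
    simp only [mul_comm Complex.I]
    exact (Complex.exp_ofReal_mul_I_im _).symm
  have hcos : ∀ ξ : ℝ, Tendsto (fun n => ∫ ω, Real.cos (ξ * R n ω) ∂P) atTop (𝓝 1) := by
    intro ξ
    simp only [hre]
    simpa [Function.comp_def] using (Complex.continuous_re.tendsto _).comp (hlim ξ)
  have hsin : ∀ ξ : ℝ, Tendsto (fun n => ∫ ω, Real.sin (ξ * R n ω) ∂P) atTop (𝓝 0) := by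
    intro ξ
    simp only [him]
    simpa [Function.comp_def] using (Complex.continuous_im.tendsto _).comp (hlim ξ)
  have hint : ∀ {f : Ω → ℝ}, Measurable f → (∀ ω, |f ω| ≤ 1) → Integrable f P :=
    fun hf hb => Integrable.of_bound hf.aestronglyMeasurable 1 (ae_of_all _ hb)
  have hpint : ∀ (n : ℕ) (ξ : ℝ) {u v : ℝ → ℝ}, Measurable u → Measurable v → (∀ x, |u x| ≤ 1) →
      (∀ x, |v x| ≤ 1) → Integrable (fun ω => u (ξ * T n ω) * v (ξ * R n ω)) P := by
    intro n ξ u v hu hv hub hvb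
    refine hint ((hu.comp ((hTm n).const_mul ξ)).mul (hv.comp ((hR n).const_mul ξ))) fun ω => ?_
    rw [abs_mul]
    exact mul_le_one₀ (hub _) (abs_nonneg _) (hvb _)
  -- the conditional expectation of a product of a function of `T n` and a function of `R n`
  have hprod : ∀ (n : ℕ) (ξ : ℝ) (u v : ℝ → ℝ), Measurable u → Measurable v → (∀ x, |u x| ≤ 1) →
      (∀ x, |v x| ≤ 1) →
      P[fun ω => u (ξ * T n ω) * v (ξ * R n ω) | ℱ n] =ᵐ[P]
        fun ω => u (ξ * T n ω) * ∫ ω', v (ξ * R n ω') ∂P := by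
    intro n ξ u v hu hv hub hvb
    have h1 := condExp_stronglyMeasurable_mul_of_bound (ℱ.le n) (f := fun ω => u (ξ * T n ω))
      (g := fun ω => v (ξ * R n ω)) (μ := P)
      (Measurable.stronglyMeasurable (hu.comp ((hT n).const_mul ξ)))
      (hint (hv.comp ((hR n).const_mul ξ)) fun ω => hvb _) 1 (ae_of_all _ fun ω => hub _)
    have h2 := condExp_indep_eq (f := fun ω => v (ξ * R n ω)) ((hR n).comap_le) (ℱ.le n)
      (Measurable.stronglyMeasurable
        (hv.comp ((comap_measurable (R n)).const_mul ξ))) (hind n)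
    filter_upwards [h1, h2] with ω hω hω2
    refine hω.trans ?_
    simp [hω2]
  -- Lévy's upward theorem for a bounded function of `S`
  have hup : ∀ (ξ : ℝ) (u : ℝ → ℝ), Continuous u → (∀ x, |u x| ≤ 1) →
      ∀ᵐ ω ∂P, Tendsto (fun n => (P[fun ω => u (ξ * S ω) | ℱ n]) ω) atTop (𝓝 (u (ξ * S ω))) := by
    intro ξ u hu hub
    have h1 := tendsto_ae_condExp (μ := P) (ℱ := ℱ) (fun ω => u (ξ * S ω))
    have h2 := condExp_of_aestronglyMeasurable' (μ := P) (iSup_le fun n => ℱ.le n)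
      (hu.comp_aestronglyMeasurable (hSm.const_mul ξ))
      (hint (hu.measurable.comp (hS.const_mul ξ)) fun ω => hub _)
    filter_upwards [h1, h2] with ω hω hω2
    exact hω2 ▸ hω
  have hb : ∀ {a b : ℕ → ℝ}, (∀ n, |a n| ≤ 1) → Tendsto b atTop (𝓝 0) →
      Tendsto (fun n => a n * b n) atTop (𝓝 0) := by
    intro a b ha hb
    exact bdd_le_mul_tendsto_zero' 1 (Eventually.of_forall ha) hb
  -- The addition formulas are the real and imaginary parts of `E[exp(iξS) | ℱ n] = exp(iξ T n) · E
  -- exp(iξ R n)`. The means of `cos(ξ R n)` and `sin(ξ R n)` tend to `1` and `0`.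
  have hξ : ∀ ξ : ℝ, ∀ᵐ ω ∂P, Tendsto (fun n => Real.cos (ξ * (T n ω - S ω))) atTop (𝓝 1) := by
    intro ξ
    have hcS : ∀ n, P[fun ω => Real.cos (ξ * S ω) | ℱ n] =ᵐ[P] fun ω =>
        Real.cos (ξ * T n ω) * (∫ ω', Real.cos (ξ * R n ω') ∂P) -
        Real.sin (ξ * T n ω) * (∫ ω', Real.sin (ξ * R n ω') ∂P) := by
      intro n
      have h0 : (fun ω => Real.cos (ξ * S ω)) =ᵐ[P]
          (fun ω => Real.cos (ξ * T n ω) * Real.cos (ξ * R n ω)) -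
            (fun ω => Real.sin (ξ * T n ω) * Real.sin (ξ * R n ω)) := by
        filter_upwards [hTR n] with ω hω
        rw [hω, mul_add, Real.cos_add, Pi.sub_apply]
      filter_upwards [condExp_congr_ae (m := ℱ n) h0,
        condExp_sub (hpint n ξ Real.measurable_cos Real.measurable_cos Real.abs_cos_le_one
          Real.abs_cos_le_one) (hpint n ξ Real.measurable_sin Real.measurable_sin
          Real.abs_sin_le_one Real.abs_sin_le_one) (ℱ n),
        hprod n ξ _ _ Real.measurable_cos Real.measurable_cos Real.abs_cos_le_one
          Real.abs_cos_le_one,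
        hprod n ξ _ _ Real.measurable_sin Real.measurable_sin Real.abs_sin_le_one
          Real.abs_sin_le_one] with ω h1 h2 h3 h4
      rw [h1, h2, Pi.sub_apply, h3, h4]
    have hsS : ∀ n, P[fun ω => Real.sin (ξ * S ω) | ℱ n] =ᵐ[P] fun ω =>
        Real.sin (ξ * T n ω) * (∫ ω', Real.cos (ξ * R n ω') ∂P) +
        Real.cos (ξ * T n ω) * (∫ ω', Real.sin (ξ * R n ω') ∂P) := by
      intro n
      have h0 : (fun ω => Real.sin (ξ * S ω)) =ᵐ[P]
          (fun ω => Real.sin (ξ * T n ω) * Real.cos (ξ * R n ω)) +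
            (fun ω => Real.cos (ξ * T n ω) * Real.sin (ξ * R n ω)) := by
        filter_upwards [hTR n] with ω hω
        rw [hω, mul_add, Real.sin_add, Pi.add_apply]
      filter_upwards [condExp_congr_ae (m := ℱ n) h0,
        condExp_add (hpint n ξ Real.measurable_sin Real.measurable_cos Real.abs_sin_le_one
          Real.abs_cos_le_one) (hpint n ξ Real.measurable_cos Real.measurable_sin
          Real.abs_cos_le_one Real.abs_sin_le_one) (ℱ n),
        hprod n ξ _ _ Real.measurable_sin Real.measurable_cos Real.abs_sin_le_one
          Real.abs_cos_le_one,
        hprod n ξ _ _ Real.measurable_cos Real.measurable_sin Real.abs_cos_le_one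
          Real.abs_sin_le_one] with ω h1 h2 h3 h4
      rw [h1, h2, Pi.add_apply, h3, h4]
    filter_upwards [ae_all_iff.2 hcS, ae_all_iff.2 hsS,
      hup ξ _ Real.continuous_cos Real.abs_cos_le_one,
      hup ξ _ Real.continuous_sin Real.abs_sin_le_one] with ω h1 h2 h3 h4
    simp only [h1] at h3
    simp only [h2] at h4
    have hc0 : Tendsto (fun n => 1 - ∫ ω', Real.cos (ξ * R n ω') ∂P) atTop (𝓝 0) := by
      simpa using (hcos ξ).const_sub 1
    have hct : Tendsto (fun n => Real.cos (ξ * T n ω)) atTop (𝓝 (Real.cos (ξ * S ω))) := by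
      have := (h3.add (hb (fun n => Real.abs_cos_le_one (ξ * T n ω)) hc0)).add
        (hb (fun n => Real.abs_sin_le_one (ξ * T n ω)) (hsin ξ))
      rw [add_zero, add_zero] at this
      exact this.congr fun n => by ring
    have hst : Tendsto (fun n => Real.sin (ξ * T n ω)) atTop (𝓝 (Real.sin (ξ * S ω))) := by
      have := (h4.add (hb (fun n => Real.abs_sin_le_one (ξ * T n ω)) hc0)).sub
        (hb (fun n => Real.abs_cos_le_one (ξ * T n ω)) (hsin ξ))
      rw [add_zero, sub_zero] at this
      exact this.congr fun n => by ring
    have := (hct.mul_const (Real.cos (ξ * S ω))).add (hst.mul_const (Real.sin (ξ * S ω)))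
    rw [show Real.cos (ξ * S ω) * Real.cos (ξ * S ω) + Real.sin (ξ * S ω) * Real.sin (ξ * S ω) = 1
      by nlinarith [Real.sin_sq_add_cos_sq (ξ * S ω)]] at this
    exact this.congr fun n => by rw [mul_sub, Real.cos_sub]
  -- The null set in `hξ` depends on `ξ`; Fubini exchanges the quantifiers, which is why the
  -- deterministic criterion allows exceptional `ξ`.
  have hswap : ∀ᵐ ω ∂P, ∀ᵐ ξ : ℝ,
      Tendsto (fun n => Real.cos (ξ * (T n ω - S ω))) atTop (𝓝 1) := by
    rw [Measure.ae_ae_comm (p := fun ω ξ =>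
      Tendsto (fun n => Real.cos (ξ * (T n ω - S ω))) atTop (𝓝 1))]
    · exact ae_of_all _ hξ
    · exact measurableSet_tendsto _ fun n => by
        have := hTm n
        fun_prop
  filter_upwards [hswap] with ω hω
  have := tendsto_zero_of_ae_tendsto_exp (hω.mono fun ξ h => exp_I_eq_one_of_cos h)
  simpa using this.add_const (S ω)

end Series

/-- Continuity bounds `ψ` by some `M` on `[-C, C]`, and `ψ 0 = 0` kills the integrand off `E`, so `M
· 1_E` dominates. The filter is general so as to cover double sequences in Cauchy arguments. -/
lemma tendsto_integral_comp_of_dominated {α ι : Type*} [MeasurableSpace α] {μ : Measure α}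
    {ψ : ℝ → ℂ} (hψ : Continuous ψ) (h0 : ψ 0 = 0) {l : Filter ι} [l.IsCountablyGenerated]
    {f : ι → α → ℝ} {g : α → ℝ} {C : ℝ} {E : Set α} (hEm : MeasurableSet E) (hE : μ E < ⊤)
    (hf : ∀ i, AEStronglyMeasurable (f i) μ) (hb : ∀ i t, |f i t| ≤ C)
    (hs : ∀ i, ∀ t ∉ E, f i t = 0) (hlim : ∀ᵐ t ∂μ, Tendsto (fun i => f i t) l (𝓝 (g t))) :
    Tendsto (fun i => ∫ t, ψ (f i t) ∂μ) l (𝓝 (∫ t, ψ (g t) ∂μ)) := by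
  obtain ⟨M, hM⟩ := (isCompact_Icc (a := -C) (b := C)).exists_bound_of_continuousOn hψ.continuousOn
  refine tendsto_integral_filter_of_dominated_convergence (E.indicator fun _ => M) ?_ ?_ ?_ ?_
  · exact Eventually.of_forall fun i => hψ.comp_aestronglyMeasurable (hf i)
  · refine Eventually.of_forall fun i => ae_of_all _ fun t => ?_
    by_cases ht : t ∈ E
    · rw [Set.indicator_of_mem ht]
      exact hM _ (abs_le.1 (hb i t))
    · rw [Set.indicator_of_notMem ht, hs i t ht, h0, norm_zero]
  · exact (integrable_indicator_iff hEm).2 (integrableOn_const hE.ne)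
  · filter_upwards [hlim] with t ht
    exact (hψ.tendsto _).comp ht

/-! ### Mollified indicators and cutoff functions. -/

section Mollification

variable {d : ℕ} {θ : TestFn d} {A : Set (Space d)}

lemma scaled_nonneg (hθ : IsMollifier θ) (n : ℕ) (t : Space d) : 0 ≤ scaled θ n t :=
  mul_nonneg (by positivity) (hθ.1 _)

lemma integral_scaled (hθ : IsMollifier θ) (n : ℕ) : ∫ t, scaled θ n t = 1 := by
  have hn : (0 : ℝ) < (n : ℝ) + 1 := by positivity
  simp only [scaled]
  rw [integral_const_mul, Measure.integral_comp_smul volume (fun t => θ t), hθ.2,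
    finrank_euclideanSpace, Fintype.card_fin, abs_of_pos (by positivity), smul_eq_mul, mul_one,
    mul_inv_cancel₀ (by positivity)]

lemma smoothedIndicator_eq (n : ℕ) (t : Space d) :
    smoothedIndicator θ n A t =
      ∫ s, scaled θ n (t - s) * A.indicator (fun _ => (1 : ℝ)) s := by
  simp [smoothedIndicator, convolution_eq_swap]

lemma integral_scaled_sub (hθ : IsMollifier θ) (n : ℕ) (t : Space d) :
    ∫ s, scaled θ n (t - s) = 1 := by
  rw [integral_sub_left_eq_self (fun s => scaled θ n s), integral_scaled hθ]

lemma abs_smoothedIndicator_le (hθ : IsMollifier θ) (n : ℕ) (t : Space d) :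
    |smoothedIndicator θ n A t| ≤ 1 := by
  rw [smoothedIndicator_eq, ← integral_scaled_sub hθ n t, ← Real.norm_eq_abs]
  refine norm_integral_le_of_norm_le ?_ (ae_of_all _ fun s => ?_)
  · exact ((contDiff_scaled θ n).continuous.integrable_of_hasCompactSupport
      (hasCompactSupport_scaled θ n)).comp_sub_left t
  · by_cases hs : s ∈ A <;> simp [hs, abs_of_nonneg, scaled_nonneg hθ, integral_scaled_sub hθ]

/-- Mollifications of an indicator function converge almost everywhere. -/
lemma ae_tendsto_smoothedIndicator (hθ : IsMollifier θ) (hA : MeasurableSet A) :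
    ∀ᵐ t : Space d, Tendsto (fun n => smoothedIndicator θ n A t) atTop
      (𝓝 (A.indicator (fun _ => (1 : ℝ)) t)) := by
  have hloc : LocallyIntegrable (A.indicator fun _ => (1 : ℝ)) (volume : Measure (Space d)) :=
    (locallyIntegrable_const (1 : ℝ)).indicator hA
  obtain ⟨R, hR, hsupp⟩ : ∃ R : ℝ, 0 < R ∧ tsupport θ ⊆ Metric.closedBall 0 R := by
    obtain ⟨R, hR⟩ := θ.hasCompactSupport.isCompact.isBounded.subset_closedBall (0 : Space d)
    exact ⟨max R 1, by positivity, hR.trans (Metric.closedBall_subset_closedBall (le_max_left _ _))⟩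
  obtain ⟨M, hM⟩ := θ.continuous.bounded_above_of_compact_support θ.hasCompactSupport
  filter_upwards [(Besicovitch.vitaliFamily (volume : Measure (Space d))).ae_tendsto_average_norm_sub
    hloc] with x h
  -- The kernel `s ↦ scaled θ n (x - s)` lives in the ball of this radius about `x`, so Lebesgue
  -- points of the indicator are to be tested on these balls.
  have hrad : Tendsto (fun n : ℕ => R / ((n : ℝ) + 1)) atTop (𝓝[>] 0) :=
    tendsto_nhdsWithin_iff.2 ⟨tendsto_const_div_atTop_nhds_zero_nat R |>.comp (tendsto_add_atTop_nat 1)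
      |>.congr fun n => by simp, Eventually.of_forall fun n => by simp only [Set.mem_Ioi]; positivity⟩
  have h' := (h.comp (Besicovitch.tendsto_filterAt volume x)).comp hrad
  simp only [smoothedIndicator_eq]
  -- With this constant, the sup bound `(n+1)^d M` of the kernel is exactly the constant divided by
  -- the volume of the ball of radius `R/(n+1)`.
  refine tendsto_integral_smul_of_tendsto_average_norm_sub
    (M * R ^ d * volume.real (Metric.closedBall (0 : Space d) 1)) h' ?_ ?_ ?_ ?_
  · exact Eventually.of_forall fun n => hloc.integrableOn_isCompact (isCompact_closedBall _ _)
  · simp only [integral_scaled_sub hθ]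
    exact tendsto_const_nhds
  · refine Eventually.of_forall fun n y hy => ?_
    have hn : (0 : ℝ) < (n : ℝ) + 1 := by positivity
    have hy' : θ (((n : ℝ) + 1) • (x - y)) ≠ 0 := fun h0 => hy (by simp [scaled, h0])
    have := hsupp (subset_tsupport _ hy')
    rw [mem_closedBall_zero_iff, norm_smul, Real.norm_of_nonneg hn.le] at this
    rw [Metric.mem_closedBall, dist_comm, dist_eq_norm, le_div_iff₀ hn]
    linarith
  · refine Eventually.of_forall fun n y => ?_
    have hn : (0 : ℝ) < (n : ℝ) + 1 := by positivity
    rw [Measure.addHaar_real_closedBall' _ _ (by positivity : 0 ≤ R / ((n : ℝ) + 1)),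
      finrank_euclideanSpace, Fintype.card_fin, scaled, abs_mul, abs_of_nonneg (by positivity)]
    have hpos : 0 < volume.real (Metric.closedBall (0 : Space d) 1) :=
      ENNReal.toReal_pos (Metric.measure_closedBall_pos _ _ one_pos).ne'
        measure_closedBall_lt_top.ne
    have : M * R ^ d * volume.real (Metric.closedBall (0 : Space d) 1) /
        ((R / ((n : ℝ) + 1)) ^ d * volume.real (Metric.closedBall (0 : Space d) 1)) =
        ((n : ℝ) + 1) ^ d * M := by
      rw [div_pow]
      field_simp
    rw [this]
    gcongr
    exact hM _

lemma exists_isMollifier (d : ℕ) : ∃ θ : TestFn d, IsMollifier θ := by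
  let b : ContDiffBump (0 : Space d) := ⟨1, 2, one_pos, one_lt_two⟩
  refine ⟨⟨b.normed volume, b.contDiff_normed, b.hasCompactSupport_normed, by simp⟩, fun t => ?_, ?_⟩
  · exact b.nonneg_normed t
  · exact b.integral_normed

lemma exists_testFn_eq_one {B : Set (Space d)} (hB : Bornology.IsBounded B) :
    ∃ φ : TestFn d, ∀ t ∈ B, φ t = 1 := by
  obtain ⟨R, hR⟩ := hB.subset_closedBall (0 : Space d)
  let b : ContDiffBump (0 : Space d) :=
    ⟨max R 1, max R 1 + 1, by positivity, lt_add_one _⟩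
  refine ⟨⟨b, b.contDiff, b.hasCompactSupport, by simp⟩, fun t ht => ?_⟩
  exact b.one_of_mem_closedBall (Metric.closedBall_subset_closedBall (le_max_left _ _) (hR ht))

end Mollification

/-! ### Extension of the noise to bounded limits of test functions. -/

section Extension

variable {d : ℕ} {Ω : Type*} [MeasurableSpace Ω] {P : Measure Ω} {X : TestFn d → Ω → ℝ} {ψ : ℝ → ℂ}

lemma IsGeneralizedRandomProcess.map_zero (hX : IsGeneralizedRandomProcess P X) :
    X 0 =ᵐ[P] 0 := by
  -- Linearity at `0 + 1 • 0` reads `X 0 = X 0 + X 0`.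
  filter_upwards [hX.linear 0 0 1] with ω hω
  simp only [one_smul, add_zero, one_mul] at hω
  simpa using hω

lemma IsGeneralizedRandomProcess.map_smul (hX : IsGeneralizedRandomProcess P X) (c : ℝ)
    (φ : TestFn d) : X (c • φ) =ᵐ[P] fun ω => c * X φ ω := by
  filter_upwards [hX.linear 0 φ c, hX.map_zero] with ω hω h0
  rw [zero_add, h0, Pi.zero_apply, zero_add] at hω
  exact hω

/-- Bounded convergence of test functions supported in a common compact set, almost everywhere. -/
def TestApprox (φ : ℕ → TestFn d) (f : Space d → ℝ) : Prop :=
  ∃ (C : ℝ) (K : Set (Space d)), IsCompact K ∧ (∀ n t, |φ n t| ≤ C) ∧ (∀ n, ∀ t ∉ K, φ n t = 0) ∧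
    ∀ᵐ t, Tendsto (fun n => φ n t) atTop (𝓝 (f t))

/-- `Y` is the limit in probability of `⟨X, φ n⟩` for some test functions `φ n` converging to `f`
in the sense of `TestApprox`. -/
def IsApprox (P : Measure Ω) (X : TestFn d → Ω → ℝ) (f : Space d → ℝ) (Y : Ω → ℝ) : Prop :=
  Measurable Y ∧ ∃ φ : ℕ → TestFn d, TestApprox φ f ∧
    TendstoInMeasure P (fun n => X (φ n)) atTop Y

lemma TestApprox.add_smul {φ φ' : ℕ → TestFn d} {f f' : Space d → ℝ} (h : TestApprox φ f)
    (h' : TestApprox φ' f') (c : ℝ) :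
    TestApprox (fun n => φ n + c • φ' n) (fun t => f t + c * f' t) := by
  obtain ⟨C, K, hK, hb, hs, hl⟩ := h
  obtain ⟨C', K', hK', hb', hs', hl'⟩ := h'
  refine ⟨C + |c| * C', K ∪ K', hK.union hK', fun n t => ?_, fun n t ht => ?_, ?_⟩
  · have h1 : (φ n + c • φ' n) t = φ n t + c * φ' n t := rfl
    rw [h1]
    refine (abs_add_le _ _).trans (add_le_add (hb n t) ?_)
    rw [abs_mul]
    exact mul_le_mul_of_nonneg_left (hb' n t) (abs_nonneg _)
  · rw [Set.mem_union, not_or] at ht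
    change φ n t + c * φ' n t = 0
    rw [hs n t ht.1, hs' n t ht.2]
    simp
  · filter_upwards [hl, hl'] with t h1 h2
    exact h1.add (h2.const_mul c)

lemma IsApprox.add_const_mul (hX : IsGeneralizedRandomProcess P X) {f f' : Space d → ℝ}
    {Y Y' : Ω → ℝ} (h : IsApprox P X f Y) (h' : IsApprox P X f' Y') (c : ℝ) :
    IsApprox P X (fun t => f t + c * f' t) (fun ω => Y ω + c * Y' ω) := by
  obtain ⟨hm, φ, hφ, hY⟩ := h
  obtain ⟨hm', φ', hφ', hY'⟩ := h'
  refine ⟨hm.add (hm'.const_mul c), _, hφ.add_smul hφ' c, ?_⟩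
  refine (tendstoInMeasure_add hY (tendstoInMeasure_const_mul c hY')).congr_left fun n => ?_
  filter_upwards [hX.linear (φ n) (φ' n) c] with ω hω
  exact hω.symm

lemma isApprox_zero (hX : IsGeneralizedRandomProcess P X) : IsApprox P X (fun _ => 0) (fun _ => 0) := by
  refine ⟨measurable_const, fun _ => 0, ⟨0, ∅, isCompact_empty, ?_, ?_, ?_⟩, ?_⟩
  · exact fun n t => abs_zero.le
  · exact fun n t _ => rfl
  · exact ae_of_all _ fun t => tendsto_const_nhds
  · have : TendstoInMeasure P (fun (_ : ℕ) (_ : Ω) => (0 : ℝ)) atTop (fun _ => 0) := by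
      intro ε hε
      simp [hε.ne']
    exact this.congr_left fun n => hX.map_zero.symm

lemma IsApprox.sum (hX : IsGeneralizedRandomProcess P X) {ι : Type*} (s : Finset ι) (c : ι → ℝ)
    {f : ι → Space d → ℝ} {Y : ι → Ω → ℝ} (h : ∀ i, IsApprox P X (f i) (Y i)) :
    IsApprox P X (fun t => ∑ i ∈ s, c i * f i t) (fun ω => ∑ i ∈ s, c i * Y i ω) := by
  classical
  induction s using Finset.induction_on with
  | empty => simpa using isApprox_zero hX
  | insert i s hi ih =>
    simp only [Finset.sum_insert hi, add_comm (c i * _)]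
    exact ih.add_const_mul hX (h i) (c i)

lemma IsApprox.const_mul (hX : IsGeneralizedRandomProcess P X) {f : Space d → ℝ} {Y : Ω → ℝ}
    (h : IsApprox P X f Y) (c : ℝ) : IsApprox P X (fun t => c * f t) (fun ω => c * Y ω) := by
  simpa using (isApprox_zero hX).add_const_mul hX h c

lemma testApprox_mollifiedProduct {φ θ : TestFn d} (hθ : IsMollifier θ) {A : Set (Space d)}
    (hA : MeasurableSet A) :
    TestApprox (fun n => mollifiedProduct φ θ n A hA)
      (fun t => φ t * A.indicator (fun _ => (1 : ℝ)) t) := by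
  obtain ⟨M, hM⟩ := φ.continuous.bounded_above_of_compact_support φ.hasCompactSupport
  refine ⟨M * 1, tsupport φ, φ.hasCompactSupport.isCompact, fun n t => ?_, fun n t ht => ?_, ?_⟩
  · change |φ t * smoothedIndicator θ n A t| ≤ M * 1
    rw [abs_mul]
    exact mul_le_mul (hM t) (abs_smoothedIndicator_le hθ n t) (abs_nonneg _)
      ((norm_nonneg _).trans (hM t))
  · change φ t * smoothedIndicator θ n A t = 0
    rw [image_eq_zero_of_notMem_tsupport ht, zero_mul]
  · filter_upwards [ae_tendsto_smoothedIndicator hθ hA] with t ht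
    exact ht.const_mul (φ t)

lemma mul_indicator_of_eq_one {φ : Space d → ℝ} {A : Set (Space d)} (hφ : ∀ t ∈ A, φ t = 1) :
    (fun t => φ t * A.indicator (fun _ => (1 : ℝ)) t) = A.indicator (fun _ => (1 : ℝ)) := by
  ext t
  by_cases ht : t ∈ A
  · simp [ht, hφ t ht]
  · simp [ht]

variable [IsProbabilityMeasure P]

/-- Both sides of the characteristic functional pass to the limit: the left by convergence in
probability, the right by domination on the common compact set. -/
lemma IsApprox.integral_exp (hX : IsLevyWhiteNoise P X ψ) {f : Space d → ℝ} {Y : Ω → ℝ}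
    (h : IsApprox P X f Y) :
    ∫ ω, Complex.exp (Complex.I * Y ω) ∂P = Complex.exp (∫ t, ψ (f t)) := by
  obtain ⟨hm, φ, ⟨C, K, hK, hb, hs, hl⟩, hY⟩ := h
  have h1 := tendsto_integral_exp_of_tendstoInMeasure (fun n => hX.measurable (φ n)) hY
  simp only [hX.charFunctional] at h1
  have h2 := tendsto_integral_comp_of_dominated hX.levyExponent.1 hX.levyExponent.2.1
    hK.measurableSet hK.measure_lt_top (fun n => (φ n).continuous.aestronglyMeasurable) hb hs hl
  exact tendsto_nhds_unique h1 ((Complex.continuous_exp.tendsto _).comp h2)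

/-- The differences `φ m - φ n` are bounded, supported in one compact set and tend to `0` a.e., so
the sequence is Cauchy in probability. -/
lemma TestApprox.exists_isApprox (hX : IsLevyWhiteNoise P X ψ) {φ : ℕ → TestFn d}
    {f : Space d → ℝ} (h : TestApprox φ f) :
    ∃ Y, Measurable Y ∧ TendstoInMeasure P (fun n => X (φ n)) atTop Y := by
  obtain ⟨C, K, hK, hb, hs, hl⟩ := h
  refine exists_tendstoInMeasure_of_cauchy (fun n => hX.measurable _) ?_
  refine tendstoInMeasure_zero_of_tendsto_charFun
    (fun p => (hX.measurable _).sub (hX.measurable _)) (ae_of_all _ fun ξ => ?_)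
  have hchar : ∀ p : ℕ × ℕ, ∫ ω, Complex.exp (Complex.I * ↑(ξ * (X (φ p.1) ω - X (φ p.2) ω))) ∂P =
      Complex.exp (∫ t, ψ (ξ * (φ p.1 t - φ p.2 t))) := by
    intro p
    have h1 := hX.charFunctional (ξ • (φ p.1 + (-1 : ℝ) • φ p.2))
    have h2 : ∀ t, (ξ • (φ p.1 + (-1 : ℝ) • φ p.2)) t = ξ * (φ p.1 t - φ p.2 t) := by
      intro t
      change ξ * (φ p.1 t + (-1 : ℝ) * φ p.2 t) = _
      ring
    simp only [h2] at h1
    rw [← h1]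
    refine integral_congr_ae ?_
    filter_upwards [hX.map_smul ξ (φ p.1 + (-1 : ℝ) • φ p.2), hX.linear (φ p.1) (φ p.2) (-1)]
      with ω hω1 hω2
    rw [hω1, hω2, neg_one_mul, sub_eq_add_neg]
  simp only [hchar]
  have h2 : Tendsto (fun p : ℕ × ℕ => ∫ t, ψ (ξ * (φ p.1 t - φ p.2 t))) atTop
      (𝓝 (∫ t : Space d, ψ ((fun _ => 0) t))) := by
    refine tendsto_integral_comp_of_dominated (C := |ξ| * (C + C)) hX.levyExponent.1
      hX.levyExponent.2.1 hK.measurableSet hK.measure_lt_top (fun p => ?_) (fun p t => ?_)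
      (fun p t ht => ?_) ?_
    · exact (continuous_const.mul ((φ p.1).continuous.sub (φ p.2).continuous)).aestronglyMeasurable
    · rw [abs_mul]
      exact mul_le_mul_of_nonneg_left ((abs_sub _ _).trans (add_le_add (hb _ _) (hb _ _)))
        (abs_nonneg _)
    · rw [hs _ t ht, hs _ t ht]
      simp
    · filter_upwards [hl] with t ht
      rw [← prod_atTop_atTop_eq]
      simpa using ((ht.comp tendsto_fst).sub (ht.comp tendsto_snd)).const_mul ξ
  simpa [hX.levyExponent.2.1, Function.comp_def] using (Complex.continuous_exp.tendsto _).comp h2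

/-- A random variable whose characteristic function is identically `1` vanishes almost surely. -/
lemma ae_eq_zero_of_integral_exp {Y : Ω → ℝ} (hm : Measurable Y)
    (h : ∀ ξ : ℝ, ∫ ω, Complex.exp (Complex.I * ↑(ξ * Y ω)) ∂P = 1) : Y =ᵐ[P] 0 := by
  have h0 : TendstoInMeasure P (fun (_ : ℕ) => Y) atTop 0 :=
    tendstoInMeasure_zero_of_tendsto_charFun (fun _ => hm)
      (ae_of_all _ fun ξ => by simp only [h ξ]; exact tendsto_const_nhds)
  have h1 : TendstoInMeasure P (fun (_ : ℕ) => Y) atTop Y := by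
    intro ε hε
    simp [hε.ne']
  exact tendstoInMeasure_ae_unique h1 h0

/-- The difference `Y - Y'` approximates `f - f = 0`. This is what makes the extension independent
of the mollifier and the cutoff. -/
lemma IsApprox.ae_eq (hX : IsLevyWhiteNoise P X ψ) {f : Space d → ℝ} {Y Y' : Ω → ℝ}
    (h : IsApprox P X f Y) (h' : IsApprox P X f Y') : Y =ᵐ[P] Y' := by
  have h1 := h.add_const_mul hX.toIsGeneralizedRandomProcess h' (-1)
  have h2 := ae_eq_zero_of_integral_exp (P := P) h1.1 fun ξ => by
    rw [(h1.const_mul hX.toIsGeneralizedRandomProcess ξ).integral_exp hX]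
    simp [hX.levyExponent.2.1]
  filter_upwards [h2] with ω hω
  simp only [Pi.zero_apply] at hω
  linarith

/-- By uniqueness of limits, one cutoff and one mollifier decide all of them; this replaces the
quantifiers of the definition by a condition stable under linear combinations. -/
lemma isBoundedIndicatorExtension_iff (hX : IsLevyWhiteNoise P X ψ) {A : Set (Space d)}
    (hA : MeasurableSet A) (hAb : Bornology.IsBounded A) {Y : Ω → ℝ} :
    IsBoundedIndicatorExtension P X A hA Y ↔ IsApprox P X (A.indicator fun _ => (1 : ℝ)) Y := by
  constructor
  · intro h
    obtain ⟨φ, hφ⟩ := exists_testFn_eq_one hAb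
    obtain ⟨θ, hθ⟩ := exists_isMollifier d
    have h1 := testApprox_mollifiedProduct (φ := φ) hθ hA
    rw [mul_indicator_of_eq_one hφ] at h1
    exact ⟨(h φ hφ).1, _, h1, (h φ hφ).2 θ hθ⟩
  · intro h φ hφ
    refine ⟨h.1, fun θ hθ => ?_⟩
    have h1 := testApprox_mollifiedProduct (φ := φ) hθ hA
    rw [mul_indicator_of_eq_one hφ] at h1
    obtain ⟨Y', hm', hY'⟩ := h1.exists_isApprox hX
    exact hY'.congr_right (IsApprox.ae_eq hX ⟨hm', _, h1, hY'⟩ h)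

lemma exists_isApprox_indicator (hX : IsLevyWhiteNoise P X ψ) {A : Set (Space d)}
    (hA : MeasurableSet A) (hAb : Bornology.IsBounded A) :
    ∃ Y, IsApprox P X (A.indicator fun _ => (1 : ℝ)) Y := by
  obtain ⟨φ, hφ⟩ := exists_testFn_eq_one hAb
  obtain ⟨θ, hθ⟩ := exists_isMollifier d
  have h1 := testApprox_mollifiedProduct (φ := φ) hθ hA
  rw [mul_indicator_of_eq_one hφ] at h1
  obtain ⟨Y, hm, hY⟩ := h1.exists_isApprox hX
  exact ⟨Y, hm, _, h1, hY⟩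

end Extension

/-! ### From bounded sets to sets of finite measure. -/

section FiniteMeasure

variable {d : ℕ}

lemma isBounded_cube (d n : ℕ) : Bornology.IsBounded (cube d n) := by
  refine (Metric.isBounded_closedBall (x := (0 : Space d)) (r := √(∑ _i : Fin d, (n : ℝ) ^ 2))).subset ?_
  intro t ht
  rw [mem_closedBall_zero_iff, EuclideanSpace.norm_eq]
  refine Real.sqrt_le_sqrt (Finset.sum_le_sum fun i _ => ?_)
  exact pow_le_pow_left₀ (norm_nonneg _) (ht i) 2

lemma eventually_mem_cube (t : Space d) : ∀ᶠ n in atTop, t ∈ cube d n := by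
  obtain ⟨N, hN⟩ := exists_nat_ge ‖t‖
  filter_upwards [eventually_ge_atTop N] with n hn i
  exact (PiLp.norm_apply_le t i).trans (hN.trans (by exact_mod_cast hn))

lemma tendsto_indicator_inter_cube (A : Set (Space d)) (t : Space d) :
    Tendsto (fun n => (A ∩ cube d n).indicator (fun _ => (1 : ℝ)) t) atTop
      (𝓝 (A.indicator (fun _ => (1 : ℝ)) t)) := by
  refine tendsto_const_nhds.congr' ?_
  filter_upwards [eventually_mem_cube t] with n hn
  by_cases ht : t ∈ A <;> simp [ht, hn]

lemma abs_indicator_one_le (A : Set (Space d)) (t : Space d) :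
    |A.indicator (fun _ => (1 : ℝ)) t| ≤ 1 := by
  by_cases ht : t ∈ A <;> simp [ht]

variable {Ω : Type*} [MeasurableSpace Ω] {P : Measure Ω} {X : TestFn d → Ω → ℝ} {ψ : ℝ → ℂ}
  [IsProbabilityMeasure P]

lemma exists_isIndicatorExtension (hX : IsLevyWhiteNoise P X ψ) {A : Set (Space d)}
    (hA : MeasurableSet A) (hAf : volume A < ⊤) : ∃ Y, IsIndicatorExtension P X A hA Y := by
  have hm : ∀ n, MeasurableSet (A ∩ cube d n) := fun n => hA.inter (measurableSet_cube d n)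
  have hb : ∀ n, Bornology.IsBounded (A ∩ cube d n) := fun n =>
    (isBounded_cube d n).subset Set.inter_subset_right
  choose Ys hYs using fun n => exists_isApprox_indicator hX (hm n) (hb n)
  suffices h : ∃ Y, Measurable Y ∧ TendstoInMeasure P Ys atTop Y by
    obtain ⟨Y, hYm, hY⟩ := h
    exact ⟨Y, hYm, Ys, fun n => (isBoundedIndicatorExtension_iff hX (hm n) (hb n)).2 (hYs n), hY⟩
  refine exists_tendstoInMeasure_of_cauchy (fun n => (hYs n).1) ?_
  refine tendstoInMeasure_zero_of_tendsto_charFun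
    (fun p => (hYs _).1.sub (hYs _).1) (ae_of_all _ fun ξ => ?_)
  have hchar : ∀ p : ℕ × ℕ, ∫ ω, Complex.exp (Complex.I * ↑(ξ * (Ys p.1 ω - Ys p.2 ω))) ∂P =
      Complex.exp (∫ t, ψ (ξ * ((A ∩ cube d p.1).indicator (fun _ => (1 : ℝ)) t -
        (A ∩ cube d p.2).indicator (fun _ => (1 : ℝ)) t))) := by
    intro p
    have h1 := (((hYs p.1).add_const_mul hX.toIsGeneralizedRandomProcess (hYs p.2) (-1)).const_mul
      hX.toIsGeneralizedRandomProcess ξ).integral_exp hX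
    simpa only [neg_one_mul, ← sub_eq_add_neg] using h1
  simp only [hchar]
  have h2 : Tendsto (fun p : ℕ × ℕ => ∫ t, ψ (ξ * ((A ∩ cube d p.1).indicator (fun _ => (1 : ℝ)) t -
      (A ∩ cube d p.2).indicator (fun _ => (1 : ℝ)) t))) atTop
      (𝓝 (∫ t : Space d, ψ ((fun _ => 0) t))) := by
    -- The dominating set is `A` itself: it may be unbounded, but its measure is finite.
    refine tendsto_integral_comp_of_dominated (C := |ξ| * (1 + 1)) hX.levyExponent.1
      hX.levyExponent.2.1 hA hAf (fun p => ?_) (fun p t => ?_) (fun p t ht => ?_) ?_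
    · exact (((measurable_const.indicator (hm _)).sub
        (measurable_const.indicator (hm _))).const_mul ξ).aestronglyMeasurable
    · rw [abs_mul]
      exact mul_le_mul_of_nonneg_left ((abs_sub _ _).trans (add_le_add (abs_indicator_one_le _ _)
        (abs_indicator_one_le _ _))) (abs_nonneg _)
    · simp [ht]
    · refine ae_of_all _ fun t => ?_
      have ht := tendsto_indicator_inter_cube A t
      rw [← prod_atTop_atTop_eq]
      simpa using ((ht.comp tendsto_fst).sub (ht.comp tendsto_snd)).const_mul ξ
  simpa [hX.levyExponent.2.1, Function.comp_def] using (Complex.continuous_exp.tendsto _).comp h2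

/-- The joint characteristic function of finitely many extensions to indicator functions. -/
lemma integral_exp_sum_indicatorExtension (hX : IsLevyWhiteNoise P X ψ) {ι : Type*} [Fintype ι]
    {A : ι → Set (Space d)} {hA : ∀ i, MeasurableSet (A i)} (hAf : ∀ i, volume (A i) < ⊤)
    {Y : ι → Ω → ℝ} (hY : ∀ i, IsIndicatorExtension P X (A i) (hA i) (Y i)) (c : ι → ℝ) :
    ∫ ω, Complex.exp (Complex.I * ↑(∑ i, c i * Y i ω)) ∂P =
      Complex.exp (∫ t, ψ (∑ i, c i * (A i).indicator (fun _ => (1 : ℝ)) t)) := by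
  have hm : ∀ i n, MeasurableSet (A i ∩ cube d n) := fun i n =>
    (hA i).inter (measurableSet_cube d n)
  have hb : ∀ i n, Bornology.IsBounded (A i ∩ cube d n) := fun i n =>
    (isBounded_cube d n).subset Set.inter_subset_right
  choose hYm Ys hYs hYlim using hY
  have hYa : ∀ n i, IsApprox P X ((A i ∩ cube d n).indicator fun _ => (1 : ℝ)) (Ys i n) :=
    fun n i => (isBoundedIndicatorExtension_iff hX (hm i n) (hb i n)).1 (hYs i n)
  have happ : ∀ n, IsApprox P X
      (fun t => ∑ i, c i * (A i ∩ cube d n).indicator (fun _ => (1 : ℝ)) t)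
      (fun ω => ∑ i, c i * Ys i n ω) :=
    fun n => IsApprox.sum hX.toIsGeneralizedRandomProcess Finset.univ c (hYa n)
  have hlim : ∀ s : Finset ι, TendstoInMeasure P (fun n ω => ∑ i ∈ s, c i * Ys i n ω) atTop
      (fun ω => ∑ i ∈ s, c i * Y i ω) := by
    classical
    intro s
    induction s using Finset.induction_on with
    | empty =>
      intro ε hε
      simp [hε.ne']
    | insert i s hi ih =>
      simp only [Finset.sum_insert hi]
      exact tendstoInMeasure_add (tendstoInMeasure_const_mul (c i) (hYlim i)) ih
  have h1 := tendsto_integral_exp_of_tendstoInMeasure (fun n => (happ n).1) (hlim Finset.univ)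
  simp only [fun n => (happ n).integral_exp hX] at h1
  refine tendsto_nhds_unique h1 ((Complex.continuous_exp.tendsto _).comp ?_)
  refine tendsto_integral_comp_of_dominated (C := ∑ i, |c i| * 1) (E := ⋃ i, A i)
    hX.levyExponent.1 hX.levyExponent.2.1 (MeasurableSet.iUnion hA)
    ((measure_iUnion_fintype_le _ _).trans_lt (ENNReal.sum_lt_top.2 fun i _ => hAf i))
    (fun n => ?_) (fun n t => ?_) (fun n t ht => ?_) ?_
  · exact (Finset.measurable_sum _ fun i _ =>
      (measurable_const.indicator (hm i n)).const_mul (c i)).aestronglyMeasurable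
  · refine (Finset.abs_sum_le_sum_abs _ _).trans (Finset.sum_le_sum fun i _ => ?_)
    rw [abs_mul]
    exact mul_le_mul_of_nonneg_left (abs_indicator_one_le _ _) (abs_nonneg _)
  · rw [Set.mem_iUnion, not_exists] at ht
    simp [ht]
  · exact ae_of_all _ fun t => tendsto_finsetSum _ fun i _ =>
      (tendsto_indicator_inter_cube (A i) t).const_mul (c i)

/-- A linear relation between indicator functions carries over to their extensions. -/
lemma ae_sum_eq_zero_of_indicator (hX : IsLevyWhiteNoise P X ψ) {ι : Type*} [Fintype ι]
    {A : ι → Set (Space d)} {hA : ∀ i, MeasurableSet (A i)} (hAf : ∀ i, volume (A i) < ⊤)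
    {Y : ι → Ω → ℝ} (hY : ∀ i, IsIndicatorExtension P X (A i) (hA i) (Y i)) (c : ι → ℝ)
    (h : ∀ t, ∑ i, c i * (A i).indicator (fun _ => (1 : ℝ)) t = 0) :
    ∀ᵐ ω ∂P, ∑ i, c i * Y i ω = 0 := by
  refine ae_eq_zero_of_integral_exp (Y := fun ω => ∑ i, c i * Y i ω)
    (Finset.measurable_sum _ fun i _ => (hY i).1.const_mul (c i)) fun ξ => ?_
  have h1 := integral_exp_sum_indicatorExtension hX hAf hY fun i => ξ * c i
  simp only [mul_assoc, ← Finset.mul_sum, h, mul_zero, hX.levyExponent.2.1, integral_zero,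
    Complex.exp_zero] at h1
  exact h1

end FiniteMeasure

/-! ### Independence and countable additivity. -/

section RandomMeasure

variable {d : ℕ} {Ω : Type*} [MeasurableSpace Ω] {P : Measure Ω} {X : TestFn d → Ω → ℝ} {ψ : ℝ → ℂ}
  [IsProbabilityMeasure P]

lemma isDeltaRing_finiteBorel (d : ℕ) : IsDeltaRing (finiteBorel d) where
  nonempty := ⟨∅, MeasurableSet.empty, by simp⟩
  union A hA B hB := ⟨hA.1.union hB.1, measure_union_lt_top hA.2 hB.2⟩
  diff A hA B hB := ⟨hA.1.diff hB.1, (measure_mono Set.sdiff_subset).trans_lt hA.2⟩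
  iInter A hA := ⟨MeasurableSet.iInter fun n => (hA n).1,
    (measure_mono (Set.iInter_subset A 0)).trans_lt (hA 0).2⟩

lemma exists_exhaustion_finiteBorel (d : ℕ) : ∃ B : ℕ → Set (Space d),
    (∀ n, B n ∈ finiteBorel d) ∧ Monotone B ∧ (⋃ n, B n) = Set.univ := by
  refine ⟨cube d, fun n => ⟨measurableSet_cube d n, (isBounded_cube d n).measure_lt_top⟩,
    fun m n hmn t ht i => (ht i).trans (Nat.cast_le.2 hmn), ?_⟩
  exact Set.eq_univ_of_forall fun t => Set.mem_iUnion.2 (eventually_mem_cube t).exists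

lemma IsIndicatorExtension.integral_exp (hX : IsLevyWhiteNoise P X ψ) {A : Set (Space d)}
    {hA : MeasurableSet A} (hAf : volume A < ⊤) {Y : Ω → ℝ} (hY : IsIndicatorExtension P X A hA Y)
    (ξ : ℝ) :
    ∫ ω, Complex.exp (Complex.I * ↑(ξ * Y ω)) ∂P = Complex.exp ((volume A).toReal * ψ ξ) := by
  have h1 := integral_exp_sum_indicatorExtension hX (ι := Unit) (A := fun _ => A)
    (hA := fun _ => hA) (fun _ => hAf) (Y := fun _ => Y) (fun _ => hY) fun _ => ξ
  simp only [Finset.univ_unique, Finset.sum_singleton] at h1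
  rw [h1]
  have h2 : (fun t => ψ (ξ * A.indicator (fun _ => (1 : ℝ)) t)) = A.indicator fun _ => ψ ξ := by
    ext t
    by_cases ht : t ∈ A <;> simp [ht, hX.levyExponent.2.1]
  rw [h2, integral_indicator_const _ hA, Complex.real_smul, measureReal_def]

lemma IsIndicatorExtension.ae_eq (hX : IsLevyWhiteNoise P X ψ) {A : Set (Space d)}
    {hA : MeasurableSet A} (hAf : volume A < ⊤) {Y Y' : Ω → ℝ}
    (hY : IsIndicatorExtension P X A hA Y) (hY' : IsIndicatorExtension P X A hA Y') :
    Y' =ᵐ[P] Y := by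
  have h1 := ae_sum_eq_zero_of_indicator hX (ι := Fin 2) (A := fun _ => A)
    (hA := fun _ => hA) (fun _ => hAf) (Y := ![Y, Y']) (fun i => by fin_cases i <;> assumption)
    ![1, -1] (fun t => by simp [Fin.sum_univ_two])
  filter_upwards [h1] with ω hω
  simp only [Fin.sum_univ_two, Matrix.cons_val_zero, Matrix.cons_val_one] at hω
  linarith

variable {Λ : Set (Space d) → Ω → ℝ}

/-- `Λ` is a choice of versions of `⟨X, 1_A⟩` for Borel sets `A` of finite measure. -/
def IsIndicatorVersion (P : Measure Ω) (X : TestFn d → Ω → ℝ) (Λ : Set (Space d) → Ω → ℝ) : Prop :=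
  ∀ (A : Set (Space d)) (hA : MeasurableSet A), volume A < ⊤ → IsIndicatorExtension P X A hA (Λ A)

lemma IsIndicatorVersion.ae_union (hX : IsLevyWhiteNoise P X ψ) (hΛ : IsIndicatorVersion P X Λ)
    {A B : Set (Space d)} (hA : A ∈ finiteBorel d) (hB : B ∈ finiteBorel d) (hAB : Disjoint A B) :
    Λ (A ∪ B) =ᵐ[P] fun ω => Λ A ω + Λ B ω := by
  have hU := (isDeltaRing_finiteBorel d).union A hA B hB
  have hC : ∀ i, (![A ∪ B, A, B] : Fin 3 → Set (Space d)) i ∈ finiteBorel d := by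
    intro i
    fin_cases i <;> assumption
  have h1 := ae_sum_eq_zero_of_indicator hX (hA := fun i => (hC i).1) (fun i => (hC i).2)
    (fun i => hΛ _ (hC i).1 (hC i).2) ![1, -1, -1] (fun t => by
      simp only [Fin.sum_univ_three, Matrix.cons_val]
      rw [Set.indicator_union_of_disjoint hAB]
      ring)
  filter_upwards [h1] with ω hω
  simp only [Fin.sum_univ_three, Matrix.cons_val] at hω
  linarith

/-- At each point at most one indicator is nonzero, and `ψ 0 = 0` handles the others. This turns the
exponent into a sum, hence the joint characteristic function into a product. -/
lemma comp_sum_indicator {ι : Type*} [Fintype ι] {ψ : ℝ → ℂ} (h0 : ψ 0 = 0) {A : ι → Set (Space d)}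
    (hd : Pairwise (Function.onFun Disjoint A)) (c : ι → ℝ) (t : Space d) :
    ψ (∑ i, c i * (A i).indicator (fun _ => (1 : ℝ)) t) =
      ∑ i, (A i).indicator (fun _ => ψ (c i)) t := by
  by_cases h : ∃ j, t ∈ A j
  · obtain ⟨j, hj⟩ := h
    have hne : ∀ i, i ≠ j → t ∉ A i := fun i hij hi => Set.disjoint_left.1 (hd hij) hi hj
    rw [Finset.sum_eq_single j (fun i _ hij => by simp [hne i hij]) (by simp),
      Finset.sum_eq_single j (fun i _ hij => by simp [hne i hij]) (by simp)]
    simp [hj]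
  · push Not at h
    simp [h, h0]

lemma IsIndicatorVersion.iIndepFun_of_fintype (hX : IsLevyWhiteNoise P X ψ)
    (hΛ : IsIndicatorVersion P X Λ) {ι : Type*} [Fintype ι] {A : ι → Set (Space d)}
    (hA : ∀ i, A i ∈ finiteBorel d) (hd : Pairwise (Function.onFun Disjoint A)) :
    ProbabilityTheory.iIndepFun (fun i => Λ (A i)) P := by
  have hY := fun i => hΛ (A i) (hA i).1 (hA i).2
  refine iIndepFun_of_charFun (fun i => (hY i).1) fun c => ?_
  rw [integral_exp_sum_indicatorExtension hX (fun i => (hA i).2) hY c]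
  simp only [fun i => (hY i).integral_exp hX (hA i).2 (c i), comp_sum_indicator hX.levyExponent.2.1 hd]
  rw [integral_finsetSum _ fun i _ =>
    (integrable_indicator_iff (hA i).1).2 (integrableOn_const (hA i).2.ne), ← Complex.exp_sum]
  congr 1
  refine Finset.sum_congr rfl fun i _ => ?_
  rw [integral_indicator_const _ (hA i).1, Complex.real_smul, measureReal_def]

lemma IsIndicatorVersion.iIndepFun (hX : IsLevyWhiteNoise P X ψ) (hΛ : IsIndicatorVersion P X Λ)
    {ι : Type*} {A : ι → Set (Space d)} (hA : ∀ i, A i ∈ finiteBorel d)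
    (hd : Pairwise (Function.onFun Disjoint A)) :
    ProbabilityTheory.iIndepFun (fun i => Λ (A i)) P := by
  rw [ProbabilityTheory.iIndepFun_iff_finset]
  intro s
  exact hΛ.iIndepFun_of_fintype hX (A := fun i : s => A i) (fun i => hA i)
    fun i j hij => hd (Subtype.coe_injective.ne hij)

/-- Countable additivity: the series converges almost surely. -/
lemma IsIndicatorVersion.ae_tendsto_sum (hX : IsLevyWhiteNoise P X ψ)
    (hΛ : IsIndicatorVersion P X Λ) {A : ℕ → Set (Space d)} (hA : ∀ n, A n ∈ finiteBorel d)
    (hd : Pairwise (Function.onFun Disjoint A)) (hU : (⋃ n, A n) ∈ finiteBorel d) :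
    ∀ᵐ ω ∂P, Tendsto (fun N => ∑ n ∈ Finset.range N, Λ (A n) ω) atTop (𝓝 (Λ (⋃ n, A n) ω)) := by
  set R : ℕ → Set (Space d) := fun n => ⋃ k, ⋃ _ : n ≤ k, A k with hRdef
  have hRmem : ∀ n, R n ∈ finiteBorel d := fun n =>
    ⟨MeasurableSet.iUnion fun k => MeasurableSet.iUnion fun _ => (hA k).1,
      (measure_mono (Set.iUnion_subset fun k => Set.iUnion_subset fun _ =>
        Set.subset_iUnion A k)).trans_lt hU.2⟩
  have hmeas : ∀ {B}, B ∈ finiteBorel d → Measurable (Λ B) := fun hB => (hΛ _ hB.1 hB.2).1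
  have hAR : ∀ {k n}, k < n → Disjoint (A k) (R n) := by
    intro k n hkn
    simp only [hRdef, Set.disjoint_iUnion_right]
    exact fun j hj => hd (hkn.trans_le hj).ne
  have hRsucc : ∀ n, R n = A n ∪ R (n + 1) := by
    intro n
    ext t
    simp only [hRdef, Set.mem_union, Set.mem_iUnion, exists_prop]
    constructor
    · rintro ⟨k, hk, ht⟩
      rcases hk.eq_or_lt with rfl | hk
      · exact Or.inl ht
      · exact Or.inr ⟨k, hk, ht⟩
    · rintro (ht | ⟨k, hk, ht⟩)
      · exact ⟨n, le_rfl, ht⟩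
      · exact ⟨k, (Nat.le_succ n).trans hk, ht⟩
  -- Strict `j < n` matches `Finset.range n`, while the tail `R n` starts at index `n`: past and
  -- tail use disjoint sets.
  let ℱ : Filtration ℕ ‹MeasurableSpace Ω› :=
    { seq := fun n => ⨆ j, ⨆ _ : j < n, MeasurableSpace.comap (Λ (A j)) inferInstance
      mono' := fun m n hmn => iSup_mono fun j => iSup_mono' fun hj => ⟨hj.trans_le hmn, le_rfl⟩
      le' := fun n => iSup_le fun j => iSup_le fun _ => (hmeas (hA j)).comap_le }
  refine ae_tendsto_of_indep_remainder (ℱ := ℱ) (R := fun n => Λ (R n)) (fun n => ?_)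
    (fun n => hmeas (hRmem n)) (hmeas hU) (fun n => ?_) (fun n => ?_) fun ξ => ?_
  · refine Finset.measurable_sum _ fun j hj => ?_
    refine (comap_measurable (Λ (A j))).mono ?_ le_rfl
    exact le_iSup₂_of_le j (Finset.mem_range.1 hj) le_rfl
  · induction n with
    | zero => simp [hRdef]
    | succ n ih =>
      have h1 := hΛ.ae_union hX (hA n) (hRmem (n + 1)) (hAR (Nat.lt_succ_self n))
      rw [← hRsucc n] at h1
      filter_upwards [ih, h1] with ω h2 h3
      rw [h2, h3, Finset.sum_range_succ, add_assoc]
  · classical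
    -- The tail (`none`) and the past sets form one pairwise disjoint family, padded by `∅` beyond
    -- `n`; grouping its independent variables separates `R n` from `ℱ n`.
    let C : Option ℕ → Set (Space d) := fun i => i.elim (R n) fun j => if j < n then A j else ∅
    have hC : ∀ i, C i ∈ finiteBorel d := by
      rintro (_ | j)
      · exact hRmem n
      · by_cases hj : j < n
        · simpa [C, hj] using hA j
        · simp [C, hj, finiteBorel]
    have hCd : Pairwise (Function.onFun Disjoint C) := by
      have h1 : ∀ j, Disjoint (C none) (C (some j)) := by
        intro j
        by_cases hj : j < n
        · simpa [C, hj] using (hAR hj).symm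
        · simp [C, hj]
      rintro (_ | i) (_ | j) hij
      · exact absurd rfl hij
      · exact h1 j
      · exact (h1 i).symm
      · by_cases hi : i < n <;> by_cases hj : j < n <;> simp only [Function.onFun, C, hi, hj,
          Option.elim_some, if_true, if_false, Set.disjoint_empty, Set.empty_disjoint]
        exact hd fun h => hij (congrArg some h)
    have hind := hΛ.iIndepFun hX hC hCd
    have h2 := ProbabilityTheory.indep_iSup_of_disjoint (fun i => (hmeas (hC i)).comap_le) hind
      (S := {none}) (T := Set.range some) (by simp)
    refine ProbabilityTheory.indep_of_indep_of_le_left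
      (ProbabilityTheory.indep_of_indep_of_le_right h2 ?_) ?_
    · refine iSup₂_le fun j hj => ?_
      refine le_iSup₂_of_le (some j) ⟨j, rfl⟩ ?_
      simp [C, hj]
    · exact le_iSup₂_of_le none rfl le_rfl
  · simp only [fun n => (hΛ _ (hRmem n).1 (hRmem n).2).integral_exp hX (hRmem n).2 ξ]
    -- Continuity from above: the tails decrease to `∅`, and the union has finite measure.
    have hvol : Tendsto (fun n => volume (R n)) atTop (𝓝 0) := by
      have hanti : Antitone R := fun m n hmn =>
        Set.iUnion_mono fun k => Set.iUnion_mono' fun hk => ⟨hmn.trans hk, subset_rfl⟩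
      have hempty : ⋂ n, R n = ∅ := by
        refine Set.eq_empty_of_forall_notMem fun t ht => ?_
        rw [Set.mem_iInter] at ht
        obtain ⟨k, hk⟩ := Set.mem_iUnion.1 (ht 0)
        obtain ⟨-, hk⟩ := Set.mem_iUnion.1 hk
        exact Set.disjoint_left.1 (hAR (Nat.lt_succ_self k)) hk (ht (k + 1))
      have := tendsto_measure_iInter_atTop (μ := volume)
        (fun n => (hRmem n).1.nullMeasurableSet) hanti ⟨0, (hRmem 0).2.ne⟩
      simpa [hempty, Function.comp_def] using this
    have hreal := (ENNReal.tendsto_toReal ENNReal.zero_ne_top).comp hvol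
    have hc : Continuous fun x : ℝ => Complex.exp (x * ψ ξ) := by fun_prop
    simpa [Function.comp_def] using (hc.tendsto _).comp hreal

end RandomMeasure

end LevyNoise

theorem theorem3p3 {d : ℕ} {Ω : Type*} [MeasurableSpace Ω] (P : Measure Ω)
    [IsProbabilityMeasure P] (X : LevyNoise.TestFn d → Ω → ℝ) (ψ : ℝ → ℂ)
    (hX : LevyNoise.IsLevyWhiteNoise P X ψ) :
    (∀ (A : Set (LevyNoise.Space d)) (hA : MeasurableSet A), volume A < ⊤ →
      ∃ Y : Ω → ℝ, LevyNoise.IsIndicatorExtension P X A hA Y ∧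
        ∀ Y' : Ω → ℝ, LevyNoise.IsIndicatorExtension P X A hA Y' → Y' =ᵐ[P] Y) ∧
    ∀ Λ : Set (LevyNoise.Space d) → Ω → ℝ,
      (∀ (A : Set (LevyNoise.Space d)) (hA : MeasurableSet A), volume A < ⊤ →
        LevyNoise.IsIndicatorExtension P X A hA (Λ A)) →
      (∀ A : Set (LevyNoise.Space d), MeasurableSet A → volume A < ⊤ → ∀ ξ : ℝ,
        ∫ ω, Complex.exp (Complex.I * ξ * Λ A ω) ∂P =
          Complex.exp ((volume A).toReal * ψ ξ)) ∧
      LevyNoise.IsIndependentlyScatteredRandomMeasure P (LevyNoise.finiteBorel d) Λ := by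
  refine ⟨fun A hA hAf => ?_, fun Λ hΛ => ⟨fun A hA hAf ξ => ?_, ?_⟩⟩
  · obtain ⟨Y, hY⟩ := LevyNoise.exists_isIndicatorExtension hX hA hAf
    exact ⟨Y, hY, fun Y' hY' => hY.ae_eq hX hAf hY'⟩
  · simpa [mul_assoc] using (hΛ A hA hAf).integral_exp hX hAf ξ
  · exact
      { deltaRing := LevyNoise.isDeltaRing_finiteBorel d
        exhaust := LevyNoise.exists_exhaustion_finiteBorel d
        measurable := fun A hA => (hΛ A hA.1 hA.2).1
        indep := fun A hA hd => LevyNoise.IsIndicatorVersion.iIndepFun hX hΛ hA hd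
        additive := fun A hA hd hU => LevyNoise.IsIndicatorVersion.ae_tendsto_sum hX hΛ hA hd hU }
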